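/- For complex $a,q$ with $|q|<1$ let $(a;q)_\infty=\prod_{n\ge 0}(1-aq^n)$ and $(a_1,\dots,a_m;q)_\infty=(a_1;q)_\infty\cdots(a_m;q)_\infty$. Let $g_1(n)$, $n\ge 0$, be the coefficients of the power series expansion $$(-q,-q^4;q^5)_\infty^2\,(q^4,q^6;q^{10})_\infty=\sum_{n=0}^\infty g_1(n)q^n\qquad(|q|<1).$$ Then for all complex $q$ with $|q|<1$ $$(-q,-q^4;q^5)_\infty^2\,(q^4,q^6;q^{10})_\infty=G_0(q^5)+q\,G_1(q^5)+q^2G_2(q^5)+q^4G_4(q^5),$$ where $$G_0(q)=\sum_{n=0}^\infty g_1(5n)q^n=\frac{1}{(q,q^4;q^5)_\infty^2\,(q^2,q^8;q^{10})_\infty},$$ $$G_1(q)=\sum_{n=0}^\infty g_1(5n+1)q^n=\frac{2}{(q,q^2,q^3,q^4;q^5)_\infty\,(q^2,q^8;q^{10})_\infty},$$ $$G_2(q)=\sum_{n=0}^\infty g_1(5n+2)q^n=\frac{1}{(q,q^4;q^5)_\infty^2\,(q^4,q^6;q^{10})_\infty},$$ $$G_4(q)=\sum_{n=0}^\infty g_1(5n+4)q^n=\frac{1}{(q^2,q^3;q^5)_\infty^2\,(q^4,q^6;q^{10})_\infty}.$$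 In particular $g_1(5n+3)=0$ for all $n\ge 0$. -/

import Mathlib

/-- The infinite `q`-shifted factorial `(a; q)_∞ = ∏_{n ≥ 0} (1 - a q ^ n)`, used for `‖q‖ < 1`. -/
noncomputable def qPoch (a q : ℂ) : ℂ := ∏' n : ℕ, (1 - a * q ^ n)

/-- The multiple symbol `(a₁, …, aₘ; q)_∞ = (a₁; q)_∞ ⋯ (aₘ; q)_∞`. -/
noncomputable def qPochList (as : List ℂ) (q : ℂ) : ℂ := (as.map fun a => qPoch a q).prod

/-- The function `(-q, -q⁴; q⁵)_∞² (q⁴, q⁶; q¹⁰)_∞` of `q` in the open unit disc. -/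
noncomputable def genG1 (q : ℂ) : ℂ :=
  qPochList [-q, -q ^ 4] (q ^ 5) ^ 2 * qPochList [q ^ 4, q ^ 6] (q ^ 10)

/-- `g1 n` is the coefficient of `q ^ n` in the power series expansion of `genG1` about `q = 0`. -/
noncomputable def g1 (n : ℕ) : ℂ := iteratedDeriv n genG1 0 / (n.factorial : ℂ)

/-- `G1comp r q = ∑_{n ≥ 0} g1 (5n + r) q ^ n`, the component of residue `r` modulo `5`. -/
noncomputable def G1comp (r : ℕ) (q : ℂ) : ℂ := ∑' n : ℕ, g1 (5 * n + r) * q ^ n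

/-!
Write `θ(z; p) = ∑ₙ zⁿ p^(n(n-1)/2)`, summed over all integers `n`. By the Jacobi triple product,
multiplying `genG1 q` by `(q⁵; q⁵)² (q¹⁰; q¹⁰)`, a function of `q⁵`, turns it into
`θ(q; q⁵)² θ(-q⁴; q¹⁰)`. Splitting the double series of `θ(q; q⁵)²` along a sublattice of index `2`,
and those of the resulting products `θ(a; q¹⁰) θ(-q⁴; q¹⁰)`, `a = q², q³`, along a sublattice of
index `5` (Schröter's formulas), dissects this function modulo `5`. With `Q = q⁵`, each component is
a single theta function times a difference of products `θ(·; Q²) θ(·; Q¹⁰)`, and by an instance of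
Weierstrass' three-term relation this difference is again a product. The component of residue `3`
vanishes because the terms that could contribute to it contain the factor `θ(-1; q⁵⁰) = 0`.
-/

open Filter Topology Finset

/-! ### Infinite products -/

theorem summable_norm_neg_mul_pow (a : ℂ) {q : ℂ} (hq : ‖q‖ < 1) :
    Summable fun n : ℕ => ‖-(a * q ^ n)‖ := by
  simpa using (summable_geometric_of_lt_one (norm_nonneg q) hq).mul_left ‖a‖

theorem multipliable_qPoch (a : ℂ) {q : ℂ} (hq : ‖q‖ < 1) :
    Multipliable fun n : ℕ => 1 - a * q ^ n := by
  simpa only [sub_eq_add_neg] using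
    multipliable_one_add_of_summable (summable_norm_neg_mul_pow a hq)

theorem tendsto_prod_range_qPoch (a : ℂ) {q : ℂ} (hq : ‖q‖ < 1) :
    Tendsto (fun N => ∏ n ∈ range N, (1 - a * q ^ n)) atTop (𝓝 (qPoch a q)) :=
  (multipliable_qPoch a hq).hasProd.tendsto_prod_nat

theorem qPoch_zero_left (q : ℂ) : qPoch 0 q = 1 := by simp [qPoch]

theorem qPoch_ne_zero {a q : ℂ} (ha : ‖a‖ < 1) (hq : ‖q‖ < 1) : qPoch a q ≠ 0 := by
  have hlt (n : ℕ) : ‖a * q ^ n‖ < 1 := by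
    rw [norm_mul, norm_pow]
    exact mul_lt_one_of_nonneg_of_lt_one_left (norm_nonneg a) ha
      (pow_le_one₀ (norm_nonneg q) hq.le)
  have hne (n : ℕ) : 1 + -(a * q ^ n) ≠ 0 := fun h =>
    (hlt n).ne (by rw [show a * q ^ n = 1 by linear_combination -h, norm_one])
  simpa only [qPoch, sub_eq_add_neg] using
    tprod_one_add_ne_zero_of_summable hne (summable_norm_neg_mul_pow a hq)

theorem qPoch_eq_one_sub_mul (a : ℂ) {q : ℂ} (hq : ‖q‖ < 1) :
    qPoch a q = (1 - a) * qPoch (a * q) q := by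
  have hshift (n : ℕ) : 1 - a * q ^ (n + 1) = 1 - a * q * q ^ n := by ring
  rw [qPoch, tprod_eq_zero_mul' (by simpa only [hshift] using multipliable_qPoch (a * q) hq)]
  simp only [hshift, pow_zero, mul_one, qPoch]

theorem qPoch_mul_qPoch_neg (a : ℂ) {q : ℂ} (hq : ‖q‖ < 1) :
    qPoch a q * qPoch (-a) q = qPoch (a ^ 2) (q ^ 2) := by
  rw [qPoch, qPoch, ← (multipliable_qPoch a hq).tprod_mul (multipliable_qPoch (-a) hq)]
  exact tprod_congr fun n => by ring

theorem norm_pow_lt_one {q : ℂ} (hq : ‖q‖ < 1) {k : ℕ} (hk : k ≠ 0) : ‖q ^ k‖ < 1 := by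
  simpa using pow_lt_one₀ (norm_nonneg q) hq hk

theorem qPoch_eq_prod_qPoch_pow (a : ℂ) {q : ℂ} (hq : ‖q‖ < 1) {k : ℕ} (hk : k ≠ 0) :
    qPoch a q = ∏ i ∈ range k, qPoch (a * q ^ i) (q ^ k) := by
  have hblocks (N : ℕ) : ∏ n ∈ range (k * N), (1 - a * q ^ n) =
      ∏ i ∈ range k, ∏ n ∈ range N, (1 - a * q ^ i * (q ^ k) ^ n) := by
    induction N with
    | zero => simp
    | succ N ih =>
      simp only [Nat.mul_succ, prod_range_add, ih, prod_range_succ, prod_mul_distrib]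
      congr 1
      exact prod_congr rfl fun i _ => by ring
  refine tendsto_nhds_unique ((tendsto_prod_range_qPoch a hq).comp
    (tendsto_id.const_mul_atTop' (Nat.pos_of_ne_zero hk))) ?_
  simpa only [Function.comp_def, id, hblocks] using tendsto_finsetProd (range k) fun i _ =>
    tendsto_prod_range_qPoch (a * q ^ i) (norm_pow_lt_one hq hk)

theorem differentiableOn_qPoch {U : Set ℂ} (hU : IsOpen U) {a b : ℂ → ℂ}
    (ha : DifferentiableOn ℂ a U) (hb : DifferentiableOn ℂ b U) (hb1 : ∀ q ∈ U, ‖b q‖ < 1) :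
    DifferentiableOn ℂ (fun q => qPoch (a q) (b q)) U := by
  have hprod : HasProdLocallyUniformlyOn (fun (n : ℕ) q => 1 + -(a q * b q ^ n))
      (fun q => ∏' n : ℕ, (1 + -(a q * b q ^ n))) U := by
    refine hasProdLocallyUniformlyOn_of_forall_compact hU fun K hKU hK => ?_
    have haK := ha.continuousOn.mono hKU
    have hbK := hb.continuousOn.mono hKU
    obtain ⟨A, hA⟩ := hK.exists_bound_of_continuousOn haK
    obtain ⟨B, hB0, hB1, hB⟩ : ∃ B, 0 ≤ B ∧ B < 1 ∧ ∀ q ∈ K, ‖b q‖ ≤ B := by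
      rcases K.eq_empty_or_nonempty with rfl | hne
      · exact ⟨0, le_rfl, one_pos, by simp⟩
      · obtain ⟨q₀, hq₀, hmax⟩ := hK.exists_isMaxOn hne hbK.norm
        exact ⟨‖b q₀‖, norm_nonneg _, hb1 q₀ (hKU hq₀), hmax⟩
    refine ((summable_geometric_of_lt_one hB0 hB1).mul_left A).hasProdUniformlyOn_nat_one_add hK
      (.of_forall fun n q hq => ?_) fun n => by fun_prop
    rw [norm_neg, norm_mul, norm_pow]
    exact mul_le_mul (hA q hq) (pow_le_pow_left₀ (norm_nonneg _) (hB q hq) n) (by positivity)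
      ((norm_nonneg _).trans (hA q hq))
  refine (hprod.differentiableOn (.of_forall fun s => ?_) hU).congr fun q _ => by
    simp only [qPoch, sub_eq_add_neg]
  simpa only [Finset.prod_fn] using DifferentiableOn.finsetProd fun n _ =>
    (by fun_prop : DifferentiableOn ℂ (fun q => 1 + -(a q * b q ^ n)) U)

/-! ### The Jacobi triple product -/

/-- The triangular number `n (n - 1) / 2` of an integer. -/
def tri (n : ℤ) : ℤ := n * (n - 1) / 2

theorem two_mul_tri (n : ℤ) : 2 * tri n = n * (n - 1) :=
  Int.mul_ediv_cancel' (Int.even_mul_pred_self n).two_dvd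

/-- The theta series `∑ z ^ n p ^ (n (n - 1) / 2)`, that is `f (z, p / z)` of Ramanujan. -/
noncomputable def theta (z p : ℂ) : ℂ := ∑' n : ℤ, z ^ n * p ^ tri n

theorem tri_add_one (n : ℤ) : tri (n + 1) = tri n + n := by
  have h1 := two_mul_tri (n + 1)
  have h2 := two_mul_tri n
  linarith

theorem tri_neg (n : ℤ) : tri (-n) = tri n + n := by
  have h1 := two_mul_tri (-n)
  have h2 := two_mul_tri n
  linarith

theorem summable_norm_theta_nat {z p : ℂ} (hz : z ≠ 0) (hp : p ≠ 0) (hp1 : ‖p‖ < 1) :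
    Summable fun n : ℕ => ‖z ^ (n : ℤ) * p ^ tri n‖ := by
  refine summable_of_ratio_test_tendsto_lt_one (l := 0) zero_lt_one
    (.of_forall fun n => norm_ne_zero_iff.2
      (mul_ne_zero (zpow_ne_zero _ hz) (zpow_ne_zero _ hp))) ?_
  have h : Tendsto (fun n : ℕ => ‖z‖ * ‖p‖ ^ n) atTop (𝓝 0) := by
    simpa using (tendsto_pow_atTop_nhds_zero_of_lt_one (norm_nonneg p) hp1).const_mul ‖z‖
  refine h.congr fun n => ?_
  have hz' : ‖z‖ ≠ 0 := norm_ne_zero_iff.2 hz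
  have hp' : ‖p‖ ≠ 0 := norm_ne_zero_iff.2 hp
  push_cast
  rw [tri_add_one, zpow_add₀ hp, zpow_add₀ hz]
  simp only [norm_norm, norm_mul, norm_zpow, norm_pow, zpow_natCast, zpow_one]
  have h1 : ‖p‖ ^ tri n ≠ 0 := zpow_ne_zero _ hp'
  field_simp

theorem summable_norm_theta {z p : ℂ} (hz : z ≠ 0) (hp : p ≠ 0) (hp1 : ‖p‖ < 1) :
    Summable fun n : ℤ => ‖z ^ n * p ^ tri n‖ := by
  refine Summable.of_nat_of_neg (summable_norm_theta_nat hz hp hp1) ?_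
  refine (summable_norm_theta_nat (div_ne_zero hp hz) hp hp1).congr fun n => ?_
  rw [tri_neg, zpow_add₀ hp, div_zpow, zpow_neg]
  congr 1
  ring

theorem continuous_qPoch_left {q : ℂ} (hq : ‖q‖ < 1) : Continuous fun a => qPoch a q :=
  continuousOn_univ.1 (differentiableOn_qPoch isOpen_univ differentiableOn_id
    (differentiableOn_const q) fun _ _ => hq).continuousOn

theorem qPoch_zpow_eq_one_sub_mul {p : ℂ} (hp : p ≠ 0) (hp1 : ‖p‖ < 1) (m : ℤ) :
    qPoch (p ^ m) p = (1 - p ^ m) * qPoch (p ^ (m + 1)) p := by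
  rw [qPoch_eq_one_sub_mul _ hp1, zpow_add_one₀ hp]

theorem qPoch_zpow_of_nonpos {p : ℂ} (hp : p ≠ 0) {m : ℤ} (hm : m ≤ 0) :
    qPoch (p ^ m) p = 0 := by
  obtain ⟨k, rfl⟩ := Int.exists_eq_neg_ofNat hm
  exact tprod_of_exists_eq_zero ⟨k, by simp [hp]⟩

theorem exists_norm_qPoch_zpow_le {p : ℂ} (hp : p ≠ 0) (hp1 : ‖p‖ < 1) :
    ∃ C, ∀ m : ℤ, ‖qPoch (p ^ m) p‖ ≤ C := by
  obtain ⟨C, hC⟩ := (isCompact_closedBall (0 : ℂ) 1).exists_bound_of_continuousOn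
    (continuous_qPoch_left hp1).continuousOn
  refine ⟨C, fun m => ?_⟩
  rcases le_total m 0 with hm | hm
  · rw [qPoch_zpow_of_nonpos hp hm, norm_zero]
    exact (norm_nonneg _).trans (hC 0 (by simp))
  · obtain ⟨k, rfl⟩ := Int.eq_ofNat_of_zero_le hm
    exact hC _ (by simpa using pow_le_one₀ (norm_nonneg p) hp1.le)

theorem tendsto_qPoch_zpow {p : ℂ} (hp : p ≠ 0) (hp1 : ‖p‖ < 1) (m : ℤ) :
    Tendsto (fun N : ℕ => qPoch (p ^ (N + m)) p) atTop (𝓝 1) := by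
  have harg : Tendsto (fun N : ℕ => p ^ (N + m : ℤ)) atTop (𝓝 0) := by
    simpa [zpow_add₀ hp] using (tendsto_pow_atTop_nhds_zero_of_norm_lt_one hp1).mul_const (p ^ m)
  simpa [qPoch_zero_left, Function.comp_def] using
    ((continuous_qPoch_left hp1).tendsto 0).comp harg

theorem qPoch_zpow_mul_recurrence {p : ℂ} (hp : p ≠ 0) (hp1 : ‖p‖ < 1) (a b : ℤ) :
    (1 - p ^ (a + b - 1)) * (1 - p ^ (a + b)) * (qPoch (p ^ (a + 1)) p * qPoch (p ^ (b + 1)) p) =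
      (1 + p ^ (a + b - 1)) * (qPoch (p ^ a) p * qPoch (p ^ b) p) +
        p ^ b * (qPoch (p ^ (a - 1)) p * qPoch (p ^ (b + 1)) p) +
        p ^ a * (qPoch (p ^ (a + 1)) p * qPoch (p ^ (b - 1)) p) := by
  have hstep := qPoch_zpow_eq_one_sub_mul hp hp1
  have hpred (m : ℤ) : qPoch (p ^ (m - 1)) p =
      (1 - p ^ (m - 1)) * ((1 - p ^ m) * qPoch (p ^ (m + 1)) p) := by
    rw [hstep (m - 1), sub_add_cancel, hstep m]
  rw [hpred a, hpred b, hstep a, hstep b]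
  simp only [zpow_sub_one₀ hp, zpow_add₀ hp]
  field_simp
  ring

/-- The summand of the finite Jacobi triple product. In the usual form
`∑ [2 N choose N + n] z ^ n p ^ (n (n - 1) / 2)` the Gaussian binomial coefficient is, up to a
factor independent of `n`, the product of the two infinite products used here; these vanish outside
`-N ≤ n ≤ N`, so that the sum can be taken over all integers. -/
noncomputable def finiteJacobiTerm (z p : ℂ) (N : ℕ) (n : ℤ) : ℂ :=
  qPoch (p ^ (N + 1 + n)) p * qPoch (p ^ (N + 1 - n)) p * (z ^ n * p ^ tri n)

theorem finiteJacobiTerm_zero_of_ne_zero (z : ℂ) {p : ℂ} (hp : p ≠ 0) {n : ℤ} (hn : n ≠ 0) :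
    finiteJacobiTerm z p 0 n = 0 := by
  rw [finiteJacobiTerm, Nat.cast_zero, zero_add]
  rcases lt_or_gt_of_ne hn with hn | hn
  · rw [qPoch_zpow_of_nonpos hp (m := 1 + n) (by omega), zero_mul, zero_mul]
  · rw [qPoch_zpow_of_nonpos hp (m := 1 - n) (by omega), mul_zero, zero_mul]

theorem finiteJacobiTerm_succ {z p : ℂ} (hz : z ≠ 0) (hp : p ≠ 0) (hp1 : ‖p‖ < 1) (N : ℕ) (n : ℤ) :
    (1 - p ^ (2 * N + 1)) * (1 - p ^ (2 * N + 2)) * finiteJacobiTerm z p (N + 1) n =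
      (1 + p ^ (2 * N + 1)) * finiteJacobiTerm z p N n +
        z * p ^ N * finiteJacobiTerm z p N (n - 1) +
        p / z * p ^ N * finiteJacobiTerm z p N (n + 1) := by
  have hrec := qPoch_zpow_mul_recurrence hp hp1 (N + 1 + n) (N + 1 - n)
  have hpred : tri (n - 1) = tri n - (n - 1) := by
    have := tri_add_one (n - 1)
    rw [sub_add_cancel] at this
    omega
  rw [show (N + 1 + n + (N + 1 - n) - 1 : ℤ) = (2 * N + 1 : ℕ) by push_cast; ring,
    show (N + 1 + n + (N + 1 - n) : ℤ) = (2 * N + 2 : ℕ) by push_cast; ring,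
    zpow_natCast, zpow_natCast] at hrec
  simp only [finiteJacobiTerm, hpred, tri_add_one, Nat.cast_add, Nat.cast_one,
    show (N + 1 + 1 + n : ℤ) = N + 1 + n + 1 by ring,
    show (N + 1 + 1 - n : ℤ) = N + 1 - n + 1 by ring,
    show (N + 1 + (n - 1) : ℤ) = N + 1 + n - 1 by ring,
    show (N + 1 - (n - 1) : ℤ) = N + 1 - n + 1 by ring,
    show (N + 1 + (n + 1) : ℤ) = N + 1 + n + 1 by ring,
    show (N + 1 - (n + 1) : ℤ) = N + 1 - n - 1 by ring]
  have hz₁ : z * p ^ N * (z ^ (n - 1) * p ^ (tri n - (n - 1))) =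
      p ^ (N + 1 - n : ℤ) * (z ^ n * p ^ tri n) := by
    simp only [zpow_sub₀ hp, zpow_sub₀ hz, zpow_add₀ hp, zpow_one, zpow_natCast]
    field_simp
  have hz₂ : p / z * p ^ N * (z ^ (n + 1) * p ^ (tri n + n)) =
      p ^ (N + 1 + n : ℤ) * (z ^ n * p ^ tri n) := by
    simp only [zpow_add₀ hp, zpow_add₀ hz, zpow_one, zpow_natCast]
    field_simp
  linear_combination z ^ n * p ^ tri n * hrec -
    qPoch (p ^ (N + 1 + n - 1 : ℤ)) p * qPoch (p ^ (N + 1 - n + 1 : ℤ)) p * hz₁ -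
    qPoch (p ^ (N + 1 + n + 1 : ℤ)) p * qPoch (p ^ (N + 1 - n - 1 : ℤ)) p * hz₂

theorem hasSum_finiteJacobiTerm {z p : ℂ} (hz : z ≠ 0) (hp : p ≠ 0) (hp1 : ‖p‖ < 1) (N : ℕ) :
    HasSum (finiteJacobiTerm z p N) (qPoch p p * qPoch (p ^ (2 * N + 1)) p *
      ∏ k ∈ range N, ((1 + z * p ^ k) * (1 + p / z * p ^ k))) := by
  induction N with
  | zero =>
    have hzero : finiteJacobiTerm z p 0 0 = qPoch p p * qPoch p p := by
      simp [finiteJacobiTerm, tri]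
    simpa [hzero] using hasSum_single 0 fun n hn => finiteJacobiTerm_zero_of_ne_zero z hp hn
  | succ N ih =>
    have hfactor (m : ℕ) (hm : m ≠ 0) : 1 - p ^ m ≠ 0 := fun h =>
      (norm_pow_lt_one hp1 hm).ne (by rw [← sub_eq_zero.1 h, norm_one])
    have hdown := ((Equiv.subRight (1 : ℤ)).hasSum_iff.2 ih).mul_left (z * p ^ N)
    have hup := ((Equiv.addRight (1 : ℤ)).hasSum_iff.2 ih).mul_left (p / z * p ^ N)
    have hsum := ((ih.mul_left (1 + p ^ (2 * N + 1))).add hdown).add hup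
    have h1 := qPoch_eq_one_sub_mul (p ^ (2 * N + 1)) hp1
    have h2 := qPoch_eq_one_sub_mul (p ^ (2 * N + 2)) hp1
    rw [← pow_succ] at h1 h2
    rw [← hasSum_mul_left_iff (mul_ne_zero (hfactor (2 * N + 1) (by omega))
      (hfactor (2 * N + 2) (by omega)))]
    convert! hsum.congr_fun (finiteJacobiTerm_succ hz hp hp1 N) using 1
    rw [prod_range_succ, h1, h2, show 2 * (N + 1) + 1 = 2 * N + 2 + 1 by ring]
    linear_combination (1 - p ^ (2 * N + 1)) * (1 - p ^ (2 * N + 2)) * qPoch p p *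
      qPoch (p ^ (2 * N + 2 + 1)) p * p ^ (2 * N + 1) *
      (∏ k ∈ range N, (1 + z * p ^ k) * (1 + p / z * p ^ k)) * mul_inv_cancel₀ hz

theorem tendsto_tsum_finiteJacobiTerm {z p : ℂ} (hz : z ≠ 0) (hp : p ≠ 0) (hp1 : ‖p‖ < 1) :
    Tendsto (fun N => ∑' n, finiteJacobiTerm z p N n) atTop (𝓝 (theta z p)) := by
  obtain ⟨C, hC⟩ := exists_norm_qPoch_zpow_le hp hp1
  refine tendsto_tsum_of_dominated_convergence ((summable_norm_theta hz hp hp1).mul_left (C * C))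
    (fun n => ?_) (.of_forall fun N n => ?_)
  · have h := ((tendsto_qPoch_zpow hp hp1 (1 + n)).mul
      (tendsto_qPoch_zpow hp hp1 (1 - n))).mul_const (z ^ n * p ^ tri n)
    simpa only [finiteJacobiTerm, add_assoc, add_sub_assoc, one_mul] using h
  · rw [finiteJacobiTerm, norm_mul, norm_mul]
    have hC0 : 0 ≤ C := (norm_nonneg _).trans (hC 0)
    gcongr <;> exact hC _

theorem jacobi_triple_product {z p : ℂ} (hz : z ≠ 0) (hp : p ≠ 0) (hp1 : ‖p‖ < 1) :
    theta z p = qPoch (-z) p * qPoch (-(p / z)) p * qPoch p p := by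
  have hone : Tendsto (fun N : ℕ => qPoch (p ^ (2 * N + 1)) p) atTop (𝓝 1) := by
    have h := (tendsto_qPoch_zpow hp hp1 1).comp
      (tendsto_id.const_mul_atTop' (show 0 < 2 by norm_num))
    simpa only [Function.comp_def, id, ← Nat.cast_add_one, zpow_natCast] using h
  have hprod := (hone.const_mul (qPoch p p)).mul
    ((tendsto_prod_range_qPoch (-z) hp1).mul (tendsto_prod_range_qPoch (-(p / z)) hp1))
  refine (tendsto_nhds_unique (tendsto_tsum_finiteJacobiTerm hz hp hp1)
    (hprod.congr fun N => ?_)).trans (by ring)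
  rw [(hasSum_finiteJacobiTerm hz hp hp1 N).tsum_eq, ← prod_mul_distrib]
  simp only [neg_mul, sub_neg_eq_add]

/-! ### Schröter's formulas and Weierstrass' relation -/

theorem theta_mul_base {z p : ℂ} (hz : z ≠ 0) (hp : p ≠ 0) :
    theta (p * z) p = z⁻¹ * theta z p := by
  rw [theta, theta, ← (Equiv.addRight (1 : ℤ)).tsum_eq fun n => z ^ n * p ^ tri n, ← tsum_mul_left]
  refine tsum_congr fun n => ?_
  rw [Equiv.coe_addRight, tri_add_one, zpow_add₀ hz, zpow_add₀ hp, mul_zpow, zpow_one]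
  field_simp

theorem theta_base_div {z p : ℂ} (hp : p ≠ 0) : theta (p / z) p = theta z p := by
  rw [theta, theta, ← (Equiv.neg ℤ).tsum_eq fun n => z ^ n * p ^ tri n]
  refine tsum_congr fun n => ?_
  rw [Equiv.neg_apply, tri_neg, zpow_add₀ hp, div_zpow, zpow_neg]
  ring

theorem theta_inv {z p : ℂ} (hz : z ≠ 0) (hp : p ≠ 0) : theta z⁻¹ p = z⁻¹ * theta z p := by
  rw [← theta_mul_base hz hp, ← theta_base_div hp, div_inv_eq_mul]

theorem theta_neg_one {p : ℂ} (hp : p ≠ 0) : theta (-1) p = 0 := by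
  have h1 := theta_mul_base (z := -1) (by norm_num) hp
  have h2 := theta_base_div (z := -1) hp
  rw [div_neg, div_one] at h2
  rw [mul_neg, mul_one, h2] at h1
  norm_num at h1
  linear_combination h1 / 2

/-- The coset decomposition of `ℤ²` modulo its sublattice of index `k² + 1` spanned by `(1, k)` and
`(k, -1)`, with coset representatives `(0, j)` for `0 ≤ j ≤ k²`. -/
def schroeterEquiv (k : ℕ) : Fin (k ^ 2 + 1) × ℤ × ℤ ≃ ℤ × ℤ where
  toFun x := (x.2.1 + k * x.2.2, k * x.2.1 - x.2.2 + (x.1 : ℕ))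
  invFun y :=
    let d := Int.divModEquiv (k ^ 2 + 1) (y.2 - k * y.1)
    (d.2, y.1 + k * d.1, -d.1)
  left_inv := by
    rintro ⟨j, s, t⟩
    have h : Int.divModEquiv (k ^ 2 + 1) (k * s - t + (j : ℕ) - k * (s + k * t)) = (-t, j) := by
      rw [← Equiv.eq_symm_apply, Int.divModEquiv_symm_apply]
      push_cast
      ring
    simp [h]
  right_inv := by
    rintro ⟨m, n⟩
    have h := (Int.divModEquiv (k ^ 2 + 1)).symm_apply_apply (n - k * m)
    rw [Int.divModEquiv_symm_apply] at h
    push_cast at h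
    ext
    · simp
    · linear_combination h

theorem tri_add_tri_schroeter (k j s t : ℤ) :
    tri (s + k * t) + tri (k * s - t + j) =
      (k ^ 2 + 1) * (tri s + tri t) + s * (tri k + k * j) + t * (tri k + 1 - j) + tri j := by
  have h₁ := two_mul_tri (s + k * t)
  have h₂ := two_mul_tri (k * s - t + j)
  have h₃ := two_mul_tri s
  have h₄ := two_mul_tri t
  have h₅ := two_mul_tri k
  have h₆ := two_mul_tri j
  refine mul_left_cancel₀ (two_ne_zero' ℤ) ?_
  linear_combination h₁ + h₂ - (k ^ 2 + 1) * (h₃ + h₄) - (s + t) * h₅ - h₆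

theorem theta_term_mul_theta_term {a c p : ℂ} (ha : a ≠ 0) (hc : c ≠ 0) (hp : p ≠ 0) (k j : ℕ)
    (s t : ℤ) :
    a ^ (s + k * t) * p ^ tri (s + k * t) * (c ^ (k * s - t + j) * p ^ tri (k * s - t + j)) =
      c ^ j * p ^ tri j *
        ((a * c ^ k * p ^ (tri k + k * j)) ^ s * (p ^ (k ^ 2 + 1)) ^ tri s *
          ((a ^ k * c⁻¹ * p ^ (tri k + 1 - j)) ^ t * (p ^ (k ^ 2 + 1)) ^ tri t)) := by
  have hpow : p ^ tri (s + k * t) * p ^ tri (k * s - t + j) =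
      p ^ tri j * (p ^ (tri k + k * j)) ^ s * (p ^ (tri k + 1 - j)) ^ t *
        (p ^ (k ^ 2 + 1)) ^ tri s * (p ^ (k ^ 2 + 1)) ^ tri t := by
    rw [← zpow_natCast p (k ^ 2 + 1)]
    simp only [← zpow_mul, ← zpow_add₀ hp, tri_add_tri_schroeter]
    congr 1
    push_cast
    ring
  rw [zpow_add₀ ha, zpow_add₀ hc, zpow_sub₀ hc, zpow_mul, zpow_mul]
  simp only [mul_zpow, inv_zpow, zpow_natCast]
  linear_combination a ^ s * (a ^ k) ^ t * (c ^ k) ^ s * (c ^ t)⁻¹ * c ^ j * hpow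

theorem hasSum_theta_mul_theta {z w p : ℂ} (hz : z ≠ 0) (hw : w ≠ 0) (hp : p ≠ 0)
    (hp1 : ‖p‖ < 1) :
    HasSum (fun x : ℤ × ℤ => z ^ x.1 * p ^ tri x.1 * (w ^ x.2 * p ^ tri x.2))
      (theta z p * theta w p) := by
  have hz' := summable_norm_theta hz hp hp1
  have hw' := summable_norm_theta hw hp hp1
  rw [theta, theta, tsum_mul_tsum_of_summable_norm hz' hw']
  exact (summable_mul_of_summable_norm hz' hw').hasSum

theorem schroeter_formula {a c p : ℂ} (ha : a ≠ 0) (hc : c ≠ 0) (hp : p ≠ 0) (hp1 : ‖p‖ < 1)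
    (k : ℕ) :
    theta a p * theta c p = ∑ j ∈ range (k ^ 2 + 1), c ^ j * p ^ tri j *
      (theta (a * c ^ k * p ^ (tri k + k * j)) (p ^ (k ^ 2 + 1)) *
        theta (a ^ k * c⁻¹ * p ^ (tri k + 1 - j)) (p ^ (k ^ 2 + 1))) := by
  have hcoset (j : ℕ) := (hasSum_theta_mul_theta (z := a * c ^ k * p ^ (tri k + k * j))
    (w := a ^ k * c⁻¹ * p ^ (tri k + 1 - j)) (by simp [*, zpow_ne_zero])
    (by simp [*, zpow_ne_zero]) (pow_ne_zero (k ^ 2 + 1) hp)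
    (norm_pow_lt_one hp1 (k ^ 2).succ_ne_zero)).mul_left (c ^ j * p ^ tri j)
  rw [← Fin.sum_univ_eq_sum_range]
  refine (((schroeterEquiv k).hasSum_iff.2 (hasSum_theta_mul_theta ha hc hp hp1)).prod_fiberwise
    fun j => (hcoset j).congr_fun fun x => ?_).unique (hasSum_fintype _)
  exact theta_term_mul_theta_term ha hc hp k j x.1 x.2

theorem theta_mul_theta_eq_add {a c p : ℂ} (ha : a ≠ 0) (hc : c ≠ 0) (hp : p ≠ 0) (hp1 : ‖p‖ < 1) :
    theta a p * theta c p = theta (a * c) (p ^ 2) * theta (p * a / c) (p ^ 2) +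
      c * (theta (p * a * c) (p ^ 2) * theta (a / c) (p ^ 2)) := by
  rw [schroeter_formula ha hc hp hp1 1]
  norm_num [sum_range_succ, tri]
  ring_nf

theorem theta_mul_theta_neg_sq {a p : ℂ} (ha : a ≠ 0) (hp : p ≠ 0) (hp1 : ‖p‖ < 1) :
    theta a p * theta (-a ^ 2) p =
      theta (-p ^ 2) (p ^ 5) *
          (theta (a ^ 5 * p) (p ^ 5) - a ^ 3 * theta (a ^ 5 * p ^ 4) (p ^ 5)) +
        theta (-p) (p ^ 5) *
          (a * theta (a ^ 5 * p ^ 2) (p ^ 5) - a ^ 2 * theta (a ^ 5 * p ^ 3) (p ^ 5)) := by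
  have hp5 : p ^ 5 ≠ 0 := pow_ne_zero 5 hp
  have hmul (k : ℕ) : theta (a ^ 5 * p ^ (5 + k)) (p ^ 5) =
      (a ^ 5 * p ^ k)⁻¹ * theta (a ^ 5 * p ^ k) (p ^ 5) := by
    rw [← theta_mul_base (by simp [ha, hp]) hp5]
    ring_nf
  have hinv (k : ℕ) : theta (-(p ^ k)⁻¹) (p ^ 5) = -(p ^ k)⁻¹ * theta (-p ^ k) (p ^ 5) := by
    rw [neg_inv, theta_inv (by simp [hp]) hp5]
  have hmul₂ := hmul 2
  have hmul₄ := hmul 4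
  have hinv₁ := hinv 1
  have hinv₂ := hinv 2
  rw [schroeter_formula ha (neg_ne_zero.2 (pow_ne_zero 2 ha)) hp hp1 2]
  norm_num [sum_range_succ, tri] at hmul₂ hmul₄ hinv₁ hinv₂ ⊢
  rw [mul_inv_cancel₀ (pow_ne_zero 2 ha), show a * (a ^ 2) ^ 2 = a ^ 5 by ring]
  simp only [one_mul, hmul₂, hmul₄, hinv₁, hinv₂, theta_neg_one hp5]
  field_simp
  ring

theorem theta_neg_mul_theta_neg_div {x y p : ℂ} (hx : x ≠ 0) (hy : y ≠ 0) (hp : p ≠ 0)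
    (hp1 : ‖p‖ < 1) :
    theta (-(x * y)) p * theta (-(x / y)) p =
      theta (x ^ 2) (p ^ 2) * theta (p * y ^ 2) (p ^ 2) -
        x / y * (theta (p * x ^ 2) (p ^ 2) * theta (y ^ 2) (p ^ 2)) := by
  rw [theta_mul_theta_eq_add (neg_ne_zero.2 (mul_ne_zero hx hy))
    (neg_ne_zero.2 (div_ne_zero hx hy)) hp hp1,
    show -(x * y) * -(x / y) = x ^ 2 by field_simp,
    show p * -(x * y) / -(x / y) = p * y ^ 2 by field_simp,
    show p * -(x * y) * -(x / y) = p * x ^ 2 by field_simp,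
    show -(x * y) / -(x / y) = y ^ 2 by field_simp, neg_mul, sub_eq_add_neg]

theorem weierstrass_three_term {x y u v p : ℂ} (hx : x ≠ 0) (hy : y ≠ 0) (hu : u ≠ 0) (hv : v ≠ 0)
    (hp : p ≠ 0) (hp1 : ‖p‖ < 1) :
    theta (-(x * y)) p * theta (-(x / y)) p * (theta (-(u * v)) p * theta (-(u / v)) p) -
        theta (-(x * v)) p * theta (-(x / v)) p * (theta (-(u * y)) p * theta (-(u / y)) p) =
      u / y * (theta (-(y * v)) p * theta (-(y / v)) p *
        (theta (-(x * u)) p * theta (-(x / u)) p)) := by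
  simp only [theta_neg_mul_theta_neg_div, *, ne_eq, not_false_eq_true]
  field_simp
  ring

theorem theta_eq_of_mul_eq {z w p : ℂ} (hp : p ≠ 0) (h : z * w = p) : theta z p = theta w p := by
  have hw : w ≠ 0 := by rintro rfl; exact hp (by rw [← h, mul_zero])
  rw [← theta_base_div hp (z := w), ← h, mul_div_cancel_right₀ z hw]

theorem qPoch_pow_ne_zero {q : ℂ} (hq : ‖q‖ < 1) {k N : ℕ} (hk : k ≠ 0) (hN : N ≠ 0) :
    qPoch (q ^ k) (q ^ N) ≠ 0 :=
  qPoch_ne_zero (norm_pow_lt_one hq hk) (norm_pow_lt_one hq hN)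

theorem qPoch_pow_ten_ne_zero {q : ℂ} (hq1 : ‖q‖ < 1) : qPoch (q ^ 10) (q ^ 10) ≠ 0 :=
  qPoch_pow_ne_zero hq1 (by norm_num) (by norm_num)

theorem theta_mul_qPoch_pow_self {z p : ℂ} (hz : z ≠ 0) (hp : p ≠ 0) (hp1 : ‖p‖ < 1) {k : ℕ}
    (hk : k ≠ 0) :
    theta z p * qPoch (p ^ k) (p ^ k) ^ k =
      qPoch p p * ∏ i ∈ range k, theta (z * p ^ i) (p ^ k) := by
  have hpk := pow_ne_zero k hp
  have hpk1 := norm_pow_lt_one hp1 hk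
  have hleft := qPoch_eq_prod_qPoch_pow (-z) hp1 hk
  have hright : qPoch (-(p / z)) p = ∏ i ∈ range k, qPoch (-(p ^ k / (z * p ^ i))) (p ^ k) := by
    rw [qPoch_eq_prod_qPoch_pow _ hp1 hk, ← prod_range_reflect]
    refine prod_congr rfl fun i hi => congrArg (qPoch · (p ^ k)) ?_
    obtain ⟨m, rfl⟩ := Nat.exists_eq_add_of_lt (mem_range.1 hi)
    rw [show i + m + 1 - 1 - i = m by omega]
    field_simp
    ring
  rw [prod_congr rfl fun i _ => jacobi_triple_product (mul_ne_zero hz (pow_ne_zero i hp)) hpk hpk1,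
    jacobi_triple_product hz hp hp1, hleft, hright]
  simp only [prod_mul_distrib, prod_const, card_range, neg_mul]
  ring

theorem theta_mul_theta_neg {z p : ℂ} (hz : z ≠ 0) (hp : p ≠ 0) (hp1 : ‖p‖ < 1) :
    theta z p * theta (-z) p * qPoch (p ^ 2) (p ^ 2) = theta (-z ^ 2) (p ^ 2) * qPoch p p ^ 2 := by
  rw [jacobi_triple_product hz hp hp1, jacobi_triple_product (neg_ne_zero.2 hz) hp hp1,
    jacobi_triple_product (by simpa) (pow_ne_zero 2 hp) (norm_pow_lt_one hp1 two_ne_zero)]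
  simp only [div_neg, neg_neg, ← div_pow, ← qPoch_mul_qPoch_neg _ hp1]
  ring

theorem theta_duplication {z r : ℂ} (hz : z ≠ 0) (hr : r ≠ 0) (hr1 : ‖r‖ < 1) :
    theta z (r ^ 2) * theta (-z) (r ^ 2) * (theta (z * r) (r ^ 2) * theta (-(z * r)) (r ^ 2)) =
      theta (-z ^ 2) (r ^ 2) * qPoch (r ^ 2) (r ^ 2) ^ 3 := by
  have hp : r ^ 2 ≠ 0 := pow_ne_zero 2 hr
  have hp1 := norm_pow_lt_one hr1 two_ne_zero
  have h₁ := theta_mul_theta_neg hz hp hp1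
  have h₂ := theta_mul_theta_neg (mul_ne_zero hz hr) hp hp1
  have h₃ := theta_mul_qPoch_pow_self (z := -z ^ 2) (by simpa) hp hp1 two_ne_zero
  rw [prod_range_succ, prod_range_one, pow_zero, mul_one, pow_one, neg_mul, ← mul_pow] at h₃
  have hne : qPoch ((r ^ 2) ^ 2) ((r ^ 2) ^ 2) ^ 2 ≠ 0 :=
    pow_ne_zero 2 (qPoch_pow_ne_zero hp1 two_ne_zero two_ne_zero)
  refine mul_right_cancel₀ hne ?_
  linear_combination
    theta (z * r) (r ^ 2) * theta (-(z * r)) (r ^ 2) * qPoch ((r ^ 2) ^ 2) ((r ^ 2) ^ 2) * h₁ +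
    theta (-z ^ 2) ((r ^ 2) ^ 2) * qPoch (r ^ 2) (r ^ 2) ^ 2 * h₂ -
    qPoch (r ^ 2) (r ^ 2) ^ 3 * h₃

theorem theta_neg_mul_qPoch_sq {r : ℂ} (hr : r ≠ 0) (hr1 : ‖r‖ < 1) :
    theta (-r) (r ^ 2) * qPoch (r ^ 2) (r ^ 2) = qPoch r r ^ 2 := by
  rw [jacobi_triple_product (neg_ne_zero.2 hr) (pow_ne_zero 2 hr) (norm_pow_lt_one hr1 two_ne_zero),
    qPoch_eq_prod_qPoch_pow r hr1 two_ne_zero, prod_range_succ, prod_range_one,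
    show -(r ^ 2 / -r) = r by field_simp]
  ring_nf

theorem theta_one_mul_theta_mul_theta_neg {r : ℂ} (hr : r ≠ 0) (hr1 : ‖r‖ < 1) :
    theta 1 (r ^ 2) * theta r (r ^ 2) * theta (-r) (r ^ 2) = 2 * qPoch (r ^ 2) (r ^ 2) ^ 3 := by
  have hp : r ^ 2 ≠ 0 := pow_ne_zero 2 hr
  have hp1 := norm_pow_lt_one hr1 two_ne_zero
  have hone : theta 1 (r ^ 2) = 2 * qPoch (-r ^ 2) (r ^ 2) ^ 2 * qPoch (r ^ 2) (r ^ 2) := by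
    rw [jacobi_triple_product one_ne_zero hp hp1, qPoch_eq_one_sub_mul (-1) hp1]
    ring_nf
  have h₁ := theta_mul_theta_neg hr hp hp1
  have h₂ := theta_neg_mul_qPoch_sq hp hp1
  have h₃ := qPoch_mul_qPoch_neg (r ^ 2) hp1
  have hne : qPoch ((r ^ 2) ^ 2) ((r ^ 2) ^ 2) ^ 2 ≠ 0 :=
    pow_ne_zero 2 (qPoch_pow_ne_zero hp1 two_ne_zero two_ne_zero)
  refine mul_right_cancel₀ hne ?_
  rw [hone]
  rw [← h₃] at h₁ h₂ ⊢
  linear_combination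
    2 * qPoch (-r ^ 2) (r ^ 2) ^ 3 * qPoch (r ^ 2) (r ^ 2) ^ 2 * h₁ +
    2 * qPoch (-r ^ 2) (r ^ 2) ^ 2 * qPoch (r ^ 2) (r ^ 2) ^ 3 * h₂

theorem qPochList_pair (a b p : ℂ) : qPochList [a, b] p = qPoch a p * qPoch b p := by
  simp [qPochList]

theorem qPochList_mul_qPochList_mul_qPoch {q : ℂ} (hq1 : ‖q‖ < 1) :
    qPochList [q, q ^ 4] (q ^ 5) * qPochList [q ^ 2, q ^ 3] (q ^ 5) * qPoch (q ^ 5) (q ^ 5) =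
      qPoch q q := by
  rw [qPoch_eq_prod_qPoch_pow q hq1 (show 5 ≠ 0 by norm_num)]
  simp only [qPochList_pair, prod_range_succ, prod_range_zero]
  ring_nf

theorem theta_pow_eq_qPochList {q : ℂ} (hq : q ≠ 0) (hq1 : ‖q‖ < 1) {k m N : ℕ} (h : k + m = N)
    (hN : N ≠ 0) :
    theta (q ^ k) (q ^ N) = qPochList [-q ^ k, -q ^ m] (q ^ N) * qPoch (q ^ N) (q ^ N) := by
  rw [jacobi_triple_product (pow_ne_zero k hq) (pow_ne_zero N hq) (norm_pow_lt_one hq1 hN),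
    qPochList_pair, ← h, pow_add, mul_div_cancel_left₀ _ (pow_ne_zero k hq)]

theorem theta_neg_pow_eq_qPochList {q : ℂ} (hq : q ≠ 0) (hq1 : ‖q‖ < 1) {k m N : ℕ}
    (h : k + m = N) (hN : N ≠ 0) :
    theta (-q ^ k) (q ^ N) = qPochList [q ^ k, q ^ m] (q ^ N) * qPoch (q ^ N) (q ^ N) := by
  rw [jacobi_triple_product (neg_ne_zero.2 (pow_ne_zero k hq)) (pow_ne_zero N hq)
    (norm_pow_lt_one hq1 hN), qPochList_pair, div_neg, neg_neg, neg_neg, ← h, pow_add,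
    mul_div_cancel_left₀ _ (pow_ne_zero k hq)]

theorem theta_neg_mul_theta_neg_sq {p : ℂ} (hp : p ≠ 0) (hp1 : ‖p‖ < 1) :
    theta (-p) (p ^ 5) * theta (-p ^ 2) (p ^ 5) = qPoch p p * qPoch (p ^ 5) (p ^ 5) := by
  have h₁ := theta_neg_pow_eq_qPochList hp hp1 (k := 1) (m := 4) (N := 5) rfl (by norm_num)
  have h₂ := theta_neg_pow_eq_qPochList hp hp1 (k := 2) (m := 3) (N := 5) rfl (by norm_num)
  rw [pow_one] at h₁
  rw [h₁, h₂, ← qPochList_mul_qPochList_mul_qPoch hp1]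
  ring

/-! ### Theta functions of nome `q ^ 10` -/

section Modulus

variable {q : ℂ} (hq : q ≠ 0) (hq1 : ‖q‖ < 1)

include hq

theorem theta_pow_symm {k m : ℕ} (N : ℕ) (h : k + m = N) :
    theta (q ^ k) (q ^ N) = theta (q ^ m) (q ^ N) :=
  theta_eq_of_mul_eq (pow_ne_zero N hq) (by rw [← pow_add, h])

theorem theta_neg_pow_symm {k m : ℕ} (N : ℕ) (h : k + m = N) :
    theta (-q ^ k) (q ^ N) = theta (-q ^ m) (q ^ N) :=
  theta_eq_of_mul_eq (pow_ne_zero N hq) (by rw [neg_mul_neg, ← pow_add, h])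

include hq1

theorem theta_self_sq_mul_qPoch_pow_ten :
    theta q (q ^ 2) * qPoch (q ^ 10) (q ^ 10) ^ 5 =
      qPoch (q ^ 2) (q ^ 2) *
        (theta q (q ^ 10) ^ 2 * theta (q ^ 3) (q ^ 10) ^ 2 * theta (q ^ 5) (q ^ 10)) := by
  have h := theta_mul_qPoch_pow_self hq (pow_ne_zero 2 hq) (norm_pow_lt_one hq1 two_ne_zero)
    (show 5 ≠ 0 by norm_num)
  have h₇ := theta_pow_symm hq (k := 7) (m := 3) 10 rfl
  have h₉ := theta_pow_symm hq (k := 9) (m := 1) 10 rfl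
  simp only [prod_range_succ, prod_range_zero, one_mul, mul_one, ← pow_mul, ← pow_succ',
    Nat.reduceMul, Nat.reduceAdd, h₇, h₉, pow_one] at h
  linear_combination h

theorem theta_one_sq_mul_qPoch_pow_ten :
    theta 1 (q ^ 2) * qPoch (q ^ 10) (q ^ 10) ^ 5 =
      qPoch (q ^ 2) (q ^ 2) *
        (theta 1 (q ^ 10) * theta (q ^ 2) (q ^ 10) ^ 2 * theta (q ^ 4) (q ^ 10) ^ 2) := by
  have h := theta_mul_qPoch_pow_self one_ne_zero (pow_ne_zero 2 hq)
    (norm_pow_lt_one hq1 two_ne_zero) (show 5 ≠ 0 by norm_num)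
  have h₆ := theta_pow_symm hq (k := 6) (m := 4) 10 rfl
  have h₈ := theta_pow_symm hq (k := 8) (m := 2) 10 rfl
  simp only [prod_range_succ, prod_range_zero, one_mul, pow_zero, ← pow_mul, Nat.reduceMul, h₆,
    h₈] at h
  linear_combination h

theorem theta_neg_sq_mul_qPoch_pow_ten :
    theta (-q ^ 2) (q ^ 5) * qPoch (q ^ 10) (q ^ 10) ^ 2 =
      qPoch (q ^ 5) (q ^ 5) * (theta (-q ^ 2) (q ^ 10) * theta (-q ^ 3) (q ^ 10)) := by
  have h := theta_mul_qPoch_pow_self (z := -q ^ 2) (by simpa) (pow_ne_zero 5 hq)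
    (norm_pow_lt_one hq1 (show 5 ≠ 0 by norm_num)) two_ne_zero
  have h₇ := theta_neg_pow_symm hq (k := 7) (m := 3) 10 rfl
  simpa only [prod_range_succ, prod_range_zero, one_mul, pow_zero, mul_one, ← pow_mul, neg_mul,
    ← pow_add, Nat.reduceMul, Nat.reduceAdd, h₇] using h

theorem theta_neg_self_mul_qPoch_pow_ten :
    theta (-q) (q ^ 5) * qPoch (q ^ 10) (q ^ 10) ^ 2 =
      qPoch (q ^ 5) (q ^ 5) * (theta (-q) (q ^ 10) * theta (-q ^ 4) (q ^ 10)) := by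
  have h := theta_mul_qPoch_pow_self (neg_ne_zero.2 hq) (pow_ne_zero 5 hq)
    (norm_pow_lt_one hq1 (show 5 ≠ 0 by norm_num)) two_ne_zero
  have h₆ := theta_neg_pow_symm hq (k := 6) (m := 4) 10 rfl
  simpa only [prod_range_succ, prod_range_zero, one_mul, pow_zero, mul_one, ← pow_mul, neg_mul,
    ← pow_succ', Nat.reduceMul, Nat.reduceAdd, h₆, pow_one] using h

theorem theta_neg_sq_duplication :
    theta (-q ^ 2) (q ^ 10) * qPoch (q ^ 10) (q ^ 10) ^ 3 =
      theta q (q ^ 10) * theta (-q) (q ^ 10) *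
        (theta (q ^ 4) (q ^ 10) * theta (-q ^ 4) (q ^ 10)) := by
  have h := theta_duplication hq (pow_ne_zero 5 hq) (norm_pow_lt_one hq1 (show 5 ≠ 0 by norm_num))
  have h₆ := theta_pow_symm hq (k := 6) (m := 4) 10 rfl
  have h₆' := theta_neg_pow_symm hq (k := 6) (m := 4) 10 rfl
  simpa only [← pow_mul, ← pow_succ', Nat.reduceMul, Nat.reduceAdd, h₆, h₆'] using h.symm

theorem theta_neg_pow_four_duplication :
    theta (-q ^ 4) (q ^ 10) * qPoch (q ^ 10) (q ^ 10) ^ 3 =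
      theta (q ^ 2) (q ^ 10) * theta (-q ^ 2) (q ^ 10) *
        (theta (q ^ 3) (q ^ 10) * theta (-q ^ 3) (q ^ 10)) := by
  have h := theta_duplication (pow_ne_zero 2 hq) (pow_ne_zero 5 hq)
    (norm_pow_lt_one hq1 (show 5 ≠ 0 by norm_num))
  have h₇ := theta_pow_symm hq (k := 7) (m := 3) 10 rfl
  have h₇' := theta_neg_pow_symm hq (k := 7) (m := 3) 10 rfl
  simpa only [← pow_mul, ← pow_add, Nat.reduceMul, Nat.reduceAdd, h₇, h₇'] using h.symm

theorem theta_neg_pow_five_mul_qPoch_pow_ten :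
    theta (-q ^ 5) (q ^ 10) * qPoch (q ^ 10) (q ^ 10) = qPoch (q ^ 5) (q ^ 5) ^ 2 := by
  simpa only [← pow_mul, Nat.reduceMul] using theta_neg_mul_qPoch_sq (pow_ne_zero 5 hq)
    (norm_pow_lt_one hq1 (show 5 ≠ 0 by norm_num))

theorem theta_neg_sq_mul_theta_neg_pow_four :
    theta (-q ^ 2) (q ^ 10) * theta (-q ^ 4) (q ^ 10) =
      qPoch (q ^ 2) (q ^ 2) * qPoch (q ^ 10) (q ^ 10) := by
  simpa only [← pow_mul, Nat.reduceMul] using theta_neg_mul_theta_neg_sq (pow_ne_zero 2 hq)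
    (norm_pow_lt_one hq1 two_ne_zero)

theorem theta_neg_sq_sq_mul_qPoch_pow_ten :
    theta (-q ^ 2) (q ^ 5) ^ 2 * qPoch (q ^ 10) (q ^ 10) ^ 5 =
      qPoch (q ^ 2) (q ^ 2) * (theta q (q ^ 10) * theta (q ^ 4) (q ^ 10)) *
        (theta (-q) (q ^ 10) * theta (-q ^ 3) (q ^ 10) ^ 2 * theta (-q ^ 5) (q ^ 10)) := by
  have hX := theta_neg_sq_mul_qPoch_pow_ten hq hq1
  have hdup := theta_neg_sq_duplication hq hq1
  have h₅ := theta_neg_pow_five_mul_qPoch_pow_ten hq hq1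
  have h₂₄ := theta_neg_sq_mul_theta_neg_pow_four hq hq1
  refine mul_right_cancel₀ (pow_ne_zero 2 (qPoch_pow_ten_ne_zero hq1)) ?_
  generalize qPoch (q ^ 10) (q ^ 10) = E at *
  linear_combination
    E ^ 3 * (theta (-q ^ 2) (q ^ 5) * E ^ 2 +
      qPoch (q ^ 5) (q ^ 5) * (theta (-q ^ 2) (q ^ 10) * theta (-q ^ 3) (q ^ 10))) * hX -
    theta (-q ^ 2) (q ^ 10) ^ 2 * theta (-q ^ 3) (q ^ 10) ^ 2 * E ^ 3 * h₅ +
    theta (-q ^ 5) (q ^ 10) * E * theta (-q ^ 2) (q ^ 10) * theta (-q ^ 3) (q ^ 10) ^ 2 * hdup +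
    theta (-q ^ 5) (q ^ 10) * E * theta (-q ^ 3) (q ^ 10) ^ 2 * theta q (q ^ 10) *
      theta (-q) (q ^ 10) * theta (q ^ 4) (q ^ 10) * h₂₄

theorem theta_neg_self_sq_mul_qPoch_pow_ten :
    theta (-q) (q ^ 5) ^ 2 * qPoch (q ^ 10) (q ^ 10) ^ 5 =
      qPoch (q ^ 2) (q ^ 2) * (theta (q ^ 2) (q ^ 10) * theta (q ^ 3) (q ^ 10)) *
        (theta (-q) (q ^ 10) ^ 2 * theta (-q ^ 3) (q ^ 10) * theta (-q ^ 5) (q ^ 10)) := by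
  have hY := theta_neg_self_mul_qPoch_pow_ten hq hq1
  have hdup := theta_neg_pow_four_duplication hq hq1
  have h₅ := theta_neg_pow_five_mul_qPoch_pow_ten hq hq1
  have h₂₄ := theta_neg_sq_mul_theta_neg_pow_four hq hq1
  refine mul_right_cancel₀ (pow_ne_zero 2 (qPoch_pow_ten_ne_zero hq1)) ?_
  generalize qPoch (q ^ 10) (q ^ 10) = E at *
  linear_combination
    E ^ 3 * (theta (-q) (q ^ 5) * E ^ 2 +
      qPoch (q ^ 5) (q ^ 5) * (theta (-q) (q ^ 10) * theta (-q ^ 4) (q ^ 10))) * hY -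
    theta (-q) (q ^ 10) ^ 2 * theta (-q ^ 4) (q ^ 10) ^ 2 * E ^ 3 * h₅ +
    theta (-q ^ 5) (q ^ 10) * E * theta (-q) (q ^ 10) ^ 2 * theta (-q ^ 4) (q ^ 10) * hdup +
    theta (-q ^ 5) (q ^ 10) * E * theta (-q) (q ^ 10) ^ 2 * theta (q ^ 2) (q ^ 10) *
      theta (q ^ 3) (q ^ 10) * theta (-q ^ 3) (q ^ 10) * h₂₄

theorem two_mul_theta_neg_mul_theta_neg_sq_mul_qPoch_pow_ten :
    2 * (theta (-q) (q ^ 5) * theta (-q ^ 2) (q ^ 5)) * qPoch (q ^ 10) (q ^ 10) ^ 5 =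
      qPoch (q ^ 2) (q ^ 2) * (theta 1 (q ^ 10) * theta (q ^ 5) (q ^ 10)) *
        (theta (-q) (q ^ 10) * theta (-q ^ 3) (q ^ 10) * theta (-q ^ 5) (q ^ 10) ^ 2) := by
  have hX := theta_neg_sq_mul_qPoch_pow_ten hq hq1
  have hY := theta_neg_self_mul_qPoch_pow_ten hq hq1
  have h₅ := theta_neg_pow_five_mul_qPoch_pow_ten hq hq1
  have h₀₅ := theta_one_mul_theta_mul_theta_neg (pow_ne_zero 5 hq)
    (norm_pow_lt_one hq1 (show 5 ≠ 0 by norm_num))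
  have h₂₄ := theta_neg_sq_mul_theta_neg_pow_four hq hq1
  simp only [← pow_mul, Nat.reduceMul] at h₀₅
  refine mul_right_cancel₀ (pow_ne_zero 2 (qPoch_pow_ten_ne_zero hq1)) ?_
  generalize qPoch (q ^ 10) (q ^ 10) = E at *
  linear_combination
    2 * E ^ 5 * theta (-q ^ 2) (q ^ 5) * hY +
    2 * E ^ 3 * qPoch (q ^ 5) (q ^ 5) * theta (-q) (q ^ 10) * theta (-q ^ 4) (q ^ 10) * hX -
    2 * E ^ 3 * theta (-q) (q ^ 10) * theta (-q ^ 4) (q ^ 10) * theta (-q ^ 2) (q ^ 10) *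
      theta (-q ^ 3) (q ^ 10) * h₅ +
    2 * E ^ 4 * theta (-q ^ 5) (q ^ 10) * theta (-q) (q ^ 10) * theta (-q ^ 3) (q ^ 10) * h₂₄ -
    E ^ 2 * theta (-q ^ 5) (q ^ 10) * theta (-q) (q ^ 10) * theta (-q ^ 3) (q ^ 10) *
      qPoch (q ^ 2) (q ^ 2) * h₀₅

theorem theta_mul_theta_sq_mul_theta_sub :
    theta q (q ^ 10) * theta (q ^ 3) (q ^ 10) ^ 2 * theta (q ^ 5) (q ^ 10) -
        theta (-q) (q ^ 10) * theta (-q ^ 3) (q ^ 10) ^ 2 * theta (-q ^ 5) (q ^ 10) =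
      q * (theta 1 (q ^ 10) * theta (q ^ 2) (q ^ 10) ^ 2 * theta (q ^ 4) (q ^ 10)) := by
  have h := weierstrass_three_term (x := q ^ 4) (u := -q ^ 2) (y := -q) (v := q) (by simpa)
    (by simpa) (by simpa) hq (pow_ne_zero 10 hq) (norm_pow_lt_one hq1 (by norm_num))
  have h₆ := theta_pow_symm hq (k := 6) (m := 4) 10 rfl
  field_simp at h
  ring_nf at h ⊢
  rw [h₆] at h
  linear_combination h

theorem theta_one_mul_theta_mul_theta_sq_sub :
    theta 1 (q ^ 10) * theta (q ^ 2) (q ^ 10) * theta (q ^ 4) (q ^ 10) ^ 2 -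
        theta q (q ^ 10) ^ 2 * theta (q ^ 3) (q ^ 10) * theta (q ^ 5) (q ^ 10) =
      theta (-q) (q ^ 10) ^ 2 * theta (-q ^ 3) (q ^ 10) * theta (-q ^ 5) (q ^ 10) := by
  have h := weierstrass_three_term (x := q ^ 4) (u := -q) (y := q) (v := -1) (by simpa)
    (by simpa) (by simpa) (by norm_num) (pow_ne_zero 10 hq) (norm_pow_lt_one hq1 (by norm_num))
  field_simp at h
  ring_nf at h ⊢
  linear_combination -h

theorem theta_sq_mul_theta_sq_sub :
    theta (q ^ 2) (q ^ 10) ^ 2 * theta (q ^ 4) (q ^ 10) ^ 2 -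
        q * (theta q (q ^ 10) ^ 2 * theta (q ^ 3) (q ^ 10) ^ 2) =
      theta (-q) (q ^ 10) * theta (-q ^ 3) (q ^ 10) * theta (-q ^ 5) (q ^ 10) ^ 2 := by
  have h := weierstrass_three_term (x := q ^ 4) (u := -q ^ 3) (y := -q ^ 2) (v := q) (by simpa)
    (by simpa) (by simpa) hq (pow_ne_zero 10 hq) (norm_pow_lt_one hq1 (by norm_num))
  have h₆ := theta_pow_symm hq (k := 6) (m := 4) 10 rfl
  have h₇ := theta_pow_symm hq (k := 7) (m := 3) 10 rfl
  field_simp at h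
  ring_nf at h ⊢
  rw [h₆, h₇] at h
  linear_combination h

theorem theta_mul_theta_pow_four_sub :
    theta q (q ^ 2) * theta (q ^ 4) (q ^ 10) - q * (theta 1 (q ^ 2) * theta q (q ^ 10)) =
      theta (-q ^ 2) (q ^ 5) ^ 2 := by
  refine mul_right_cancel₀ (pow_ne_zero 5 (qPoch_pow_ten_ne_zero hq1)) ?_
  rw [theta_neg_sq_sq_mul_qPoch_pow_ten hq hq1]
  linear_combination
    theta (q ^ 4) (q ^ 10) * theta_self_sq_mul_qPoch_pow_ten hq hq1 -
    q * theta q (q ^ 10) * theta_one_sq_mul_qPoch_pow_ten hq hq1 +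
    qPoch (q ^ 2) (q ^ 2) * theta q (q ^ 10) * theta (q ^ 4) (q ^ 10) *
      theta_mul_theta_sq_mul_theta_sub hq hq1

theorem theta_one_mul_theta_pow_three_sub :
    theta 1 (q ^ 2) * theta (q ^ 3) (q ^ 10) - theta q (q ^ 2) * theta (q ^ 2) (q ^ 10) =
      theta (-q) (q ^ 5) ^ 2 := by
  refine mul_right_cancel₀ (pow_ne_zero 5 (qPoch_pow_ten_ne_zero hq1)) ?_
  rw [theta_neg_self_sq_mul_qPoch_pow_ten hq hq1]
  linear_combination
    theta (q ^ 3) (q ^ 10) * theta_one_sq_mul_qPoch_pow_ten hq hq1 -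
    theta (q ^ 2) (q ^ 10) * theta_self_sq_mul_qPoch_pow_ten hq hq1 +
    qPoch (q ^ 2) (q ^ 2) * theta (q ^ 2) (q ^ 10) * theta (q ^ 3) (q ^ 10) *
      theta_one_mul_theta_mul_theta_sq_sub hq hq1

theorem theta_one_mul_theta_pow_five_sub :
    theta 1 (q ^ 2) * theta (q ^ 5) (q ^ 10) - q * (theta q (q ^ 2) * theta 1 (q ^ 10)) =
      2 * (theta (-q) (q ^ 5) * theta (-q ^ 2) (q ^ 5)) := by
  refine mul_right_cancel₀ (pow_ne_zero 5 (qPoch_pow_ten_ne_zero hq1)) ?_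
  rw [two_mul_theta_neg_mul_theta_neg_sq_mul_qPoch_pow_ten hq hq1]
  linear_combination
    theta (q ^ 5) (q ^ 10) * theta_one_sq_mul_qPoch_pow_ten hq hq1 -
    q * theta 1 (q ^ 10) * theta_self_sq_mul_qPoch_pow_ten hq hq1 +
    qPoch (q ^ 2) (q ^ 2) * theta 1 (q ^ 10) * theta (q ^ 5) (q ^ 10) *
      theta_sq_mul_theta_sq_sub hq hq1

theorem theta_self_pow_five_sq :
    theta q (q ^ 5) ^ 2 = theta (q ^ 2) (q ^ 10) * theta (q ^ 5) (q ^ 10) +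
      q * (theta (q ^ 3) (q ^ 10) * theta 1 (q ^ 10)) := by
  have h := theta_mul_theta_eq_add hq hq (pow_ne_zero 5 hq)
    (norm_pow_lt_one hq1 (show 5 ≠ 0 by norm_num))
  have h₇ := theta_pow_symm hq (k := 7) (m := 3) 10 rfl
  rw [mul_div_cancel_right₀ _ hq, div_self hq] at h
  simpa only [← sq, ← pow_mul, ← pow_succ, Nat.reduceMul, Nat.reduceAdd, h₇] using h

theorem theta_sq_mul_theta_neg_pow_four :
    theta (q ^ 2) (q ^ 10) * theta (-q ^ 4) (q ^ 10) =
      theta (-q ^ 20) (q ^ 50) * (theta (q ^ 20) (q ^ 50) - q ^ 6 * theta 1 (q ^ 50)) +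
        theta (-q ^ 10) (q ^ 50) *
          (q ^ 2 * theta (q ^ 20) (q ^ 50) - q ^ 4 * theta (q ^ 10) (q ^ 50)) := by
  have h := theta_mul_theta_neg_sq (pow_ne_zero 2 hq) (pow_ne_zero 10 hq)
    (norm_pow_lt_one hq1 (show 10 ≠ 0 by norm_num))
  have h₃₀ := theta_pow_symm hq (k := 30) (m := 20) 50 rfl
  have h₄₀ := theta_pow_symm hq (k := 40) (m := 10) 50 rfl
  have h₅₀ := theta_pow_symm hq (k := 50) (m := 0) 50 rfl
  simpa only [← pow_mul, ← pow_add, Nat.reduceMul, Nat.reduceAdd, h₃₀, h₄₀, h₅₀, pow_zero] using h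

theorem theta_pow_three_mul_theta_neg_pow_four :
    theta (q ^ 3) (q ^ 10) * theta (-q ^ 4) (q ^ 10) =
      theta (-q ^ 20) (q ^ 50) * (theta (q ^ 25) (q ^ 50) - q ^ 4 * theta (q ^ 5) (q ^ 50)) +
        theta (-q ^ 10) (q ^ 50) *
          (q ^ 3 * theta (q ^ 15) (q ^ 50) - q ^ 6 * theta (q ^ 5) (q ^ 50)) := by
  have h := theta_mul_theta_neg_sq (pow_ne_zero 3 hq) (pow_ne_zero 10 hq)
    (norm_pow_lt_one hq1 (show 10 ≠ 0 by norm_num))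
  have h₆ := theta_neg_pow_symm hq (k := 6) (m := 4) 10 rfl
  have h₃₅ := theta_pow_symm hq (k := 35) (m := 15) 50 rfl
  have h₄₅ := theta_pow_symm hq (k := 45) (m := 5) 50 rfl
  have h₅₅ : theta (q ^ 55) (q ^ 50) = (q ^ 5)⁻¹ * theta (q ^ 5) (q ^ 50) := by
    rw [← theta_mul_base (pow_ne_zero 5 hq) (pow_ne_zero 50 hq), ← pow_add]
  simp only [← pow_mul, ← pow_add, Nat.reduceMul, Nat.reduceAdd, h₆, h₃₅, h₄₅, h₅₅] at h
  rw [h]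
  field_simp

theorem theta_five_dissection :
    theta q (q ^ 5) ^ 2 * theta (-q ^ 4) (q ^ 10) =
      theta (-q ^ 20) (q ^ 50) * (theta (-q ^ 10) (q ^ 25) ^ 2 +
          q * (2 * (theta (-q ^ 5) (q ^ 25) * theta (-q ^ 10) (q ^ 25)))) +
        theta (-q ^ 10) (q ^ 50) * (q ^ 2 * theta (-q ^ 10) (q ^ 25) ^ 2 +
          q ^ 4 * theta (-q ^ 5) (q ^ 25) ^ 2) := by
  have hQ := pow_ne_zero 5 hq
  have hQ1 := norm_pow_lt_one hq1 (show 5 ≠ 0 by norm_num)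
  have hXX := theta_mul_theta_pow_four_sub hQ hQ1
  have hYY := theta_one_mul_theta_pow_three_sub hQ hQ1
  have hXY := theta_one_mul_theta_pow_five_sub hQ hQ1
  simp only [← pow_mul, Nat.reduceMul] at hXX hYY hXY
  rw [theta_self_pow_five_sq hq hq1, ← hXX, ← hYY, ← hXY]
  linear_combination theta (q ^ 5) (q ^ 10) * theta_sq_mul_theta_neg_pow_four hq hq1 +
    q * theta 1 (q ^ 10) * theta_pow_three_mul_theta_neg_pow_four hq hq1

end Modulus

/-! ### The dissection of `genG1` -/

/-- The infinite product equal to the component of residue `r` modulo `5` of the power series of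
`genG1`. The components of residue `3` and of residues `r ≥ 5`, which do not occur, are set to
`0`. -/
noncomputable def dissectionProduct : ℕ → ℂ → ℂ
  | 0, q => 1 / (qPochList [q, q ^ 4] (q ^ 5) ^ 2 * qPochList [q ^ 2, q ^ 8] (q ^ 10))
  | 1, q => 2 / (qPochList [q, q ^ 2, q ^ 3, q ^ 4] (q ^ 5) * qPochList [q ^ 2, q ^ 8] (q ^ 10))
  | 2, q => 1 / (qPochList [q, q ^ 4] (q ^ 5) ^ 2 * qPochList [q ^ 4, q ^ 6] (q ^ 10))
  | 4, q => 1 / (qPochList [q ^ 2, q ^ 3] (q ^ 5) ^ 2 * qPochList [q ^ 4, q ^ 6] (q ^ 10))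
  | _, _ => 0

theorem genG1_mul_qPoch {q : ℂ} (hq : q ≠ 0) (hq1 : ‖q‖ < 1) :
    genG1 q * (qPoch (q ^ 5) (q ^ 5) ^ 2 * qPoch (q ^ 10) (q ^ 10)) =
      theta q (q ^ 5) ^ 2 * theta (-q ^ 4) (q ^ 10) := by
  have h₁ := theta_pow_eq_qPochList hq hq1 (k := 1) (m := 4) (N := 5) rfl (by norm_num)
  have h₄ := theta_neg_pow_eq_qPochList hq hq1 (k := 4) (m := 6) (N := 10) rfl (by norm_num)
  rw [pow_one] at h₁
  rw [h₁, h₄, genG1]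
  ring

theorem qPochList_pow_ne_zero {q : ℂ} (hq1 : ‖q‖ < 1) {ks : List ℕ} (hks : 0 ∉ ks) {N : ℕ}
    (hN : N ≠ 0) : qPochList (ks.map fun k => q ^ k) (q ^ N) ≠ 0 := by
  rw [qPochList, ne_eq, List.prod_eq_zero_iff]
  simp only [List.map_map, List.mem_map, Function.comp, not_exists, not_and]
  exact fun k hk => qPoch_pow_ne_zero hq1 (fun h0 => hks (h0 ▸ hk)) hN

section Components

variable {q : ℂ} (hq1 : ‖q‖ < 1)

include hq1

theorem qPochList_self_pow_four_ne_zero : qPochList [q, q ^ 4] (q ^ 5) ≠ 0 := by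
  simpa using qPochList_pow_ne_zero hq1 (ks := [1, 4]) (by simp) (show 5 ≠ 0 by norm_num)

theorem qPochList_sq_pow_three_ne_zero : qPochList [q ^ 2, q ^ 3] (q ^ 5) ≠ 0 := by
  simpa using qPochList_pow_ne_zero hq1 (ks := [2, 3]) (by simp) (show 5 ≠ 0 by norm_num)

theorem qPochList_sq_pow_eight_ne_zero : qPochList [q ^ 2, q ^ 8] (q ^ 10) ≠ 0 :=
  qPochList_pow_ne_zero hq1 (ks := [2, 8]) (by simp) (by norm_num)

theorem qPochList_pow_four_pow_six_ne_zero : qPochList [q ^ 4, q ^ 6] (q ^ 10) ≠ 0 :=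
  qPochList_pow_ne_zero hq1 (ks := [4, 6]) (by simp) (by norm_num)

theorem qPochList_mul_qPochList_mul_qPoch_pow_ten :
    qPochList [q ^ 2, q ^ 8] (q ^ 10) * qPochList [q ^ 4, q ^ 6] (q ^ 10) *
      qPoch (q ^ 10) (q ^ 10) = qPoch (q ^ 2) (q ^ 2) := by
  simpa only [← pow_mul, Nat.reduceMul] using
    qPochList_mul_qPochList_mul_qPoch (norm_pow_lt_one hq1 two_ne_zero)

variable (hq : q ≠ 0)

include hq

theorem theta_neg_self_eq_qPochList :
    theta (-q) (q ^ 5) = qPochList [q, q ^ 4] (q ^ 5) * qPoch (q ^ 5) (q ^ 5) := by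
  simpa using theta_neg_pow_eq_qPochList hq hq1 (k := 1) (m := 4) (N := 5) rfl (by norm_num)

theorem dissectionProduct_zero_mul_qPoch :
    dissectionProduct 0 q * (qPoch q q ^ 2 * qPoch (q ^ 2) (q ^ 2)) =
      theta (-q ^ 4) (q ^ 10) * theta (-q ^ 2) (q ^ 5) ^ 2 := by
  have h₁ := qPochList_self_pow_four_ne_zero hq1
  have h₂ := qPochList_sq_pow_eight_ne_zero hq1
  rw [theta_neg_pow_eq_qPochList hq hq1 (m := 6) rfl (by norm_num),
    theta_neg_pow_eq_qPochList hq hq1 (m := 3) rfl (by norm_num), dissectionProduct,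
    ← qPochList_mul_qPochList_mul_qPoch hq1, ← qPochList_mul_qPochList_mul_qPoch_pow_ten hq1]
  field_simp

theorem dissectionProduct_one_mul_qPoch :
    dissectionProduct 1 q * (qPoch q q ^ 2 * qPoch (q ^ 2) (q ^ 2)) =
      theta (-q ^ 4) (q ^ 10) * (2 * (theta (-q) (q ^ 5) * theta (-q ^ 2) (q ^ 5))) := by
  have h₁ := qPochList_self_pow_four_ne_zero hq1
  have h₂ := qPochList_sq_pow_three_ne_zero hq1
  have h₃ := qPochList_sq_pow_eight_ne_zero hq1
  have hlist : qPochList [q, q ^ 2, q ^ 3, q ^ 4] (q ^ 5) =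
      qPochList [q, q ^ 4] (q ^ 5) * qPochList [q ^ 2, q ^ 3] (q ^ 5) := by
    simp only [qPochList, List.map_cons, List.map_nil, List.prod_cons, List.prod_nil]
    ring
  rw [theta_neg_pow_eq_qPochList hq hq1 (m := 6) rfl (by norm_num),
    theta_neg_pow_eq_qPochList hq hq1 (m := 3) rfl (by norm_num),
    theta_neg_self_eq_qPochList hq1 hq, dissectionProduct, hlist,
    ← qPochList_mul_qPochList_mul_qPoch hq1, ← qPochList_mul_qPochList_mul_qPoch_pow_ten hq1]
  field_simp

theorem dissectionProduct_two_mul_qPoch :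
    dissectionProduct 2 q * (qPoch q q ^ 2 * qPoch (q ^ 2) (q ^ 2)) =
      theta (-q ^ 2) (q ^ 10) * theta (-q ^ 2) (q ^ 5) ^ 2 := by
  have h₁ := qPochList_self_pow_four_ne_zero hq1
  have h₂ := qPochList_pow_four_pow_six_ne_zero hq1
  rw [theta_neg_pow_eq_qPochList hq hq1 (m := 8) rfl (by norm_num),
    theta_neg_pow_eq_qPochList hq hq1 (m := 3) rfl (by norm_num), dissectionProduct,
    ← qPochList_mul_qPochList_mul_qPoch hq1, ← qPochList_mul_qPochList_mul_qPoch_pow_ten hq1]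
  field_simp

theorem dissectionProduct_four_mul_qPoch :
    dissectionProduct 4 q * (qPoch q q ^ 2 * qPoch (q ^ 2) (q ^ 2)) =
      theta (-q ^ 2) (q ^ 10) * theta (-q) (q ^ 5) ^ 2 := by
  have h₁ := qPochList_sq_pow_three_ne_zero hq1
  have h₂ := qPochList_pow_four_pow_six_ne_zero hq1
  rw [theta_neg_pow_eq_qPochList hq hq1 (m := 8) rfl (by norm_num),
    theta_neg_self_eq_qPochList hq1 hq, dissectionProduct,
    ← qPochList_mul_qPochList_mul_qPoch hq1, ← qPochList_mul_qPochList_mul_qPoch_pow_ten hq1]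
  field_simp

end Components

theorem genG1_eq_dissection {q : ℂ} (hq1 : ‖q‖ < 1) :
    genG1 q = dissectionProduct 0 (q ^ 5) + q * dissectionProduct 1 (q ^ 5) +
      q ^ 2 * dissectionProduct 2 (q ^ 5) + q ^ 4 * dissectionProduct 4 (q ^ 5) := by
  rcases eq_or_ne q 0 with rfl | hq
  · simp [genG1, dissectionProduct, qPochList, qPoch_zero_left]
  have hQ := pow_ne_zero 5 hq
  have hQ1 := norm_pow_lt_one hq1 (show 5 ≠ 0 by norm_num)
  have h₀ := dissectionProduct_zero_mul_qPoch hQ1 hQ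
  have h₁ := dissectionProduct_one_mul_qPoch hQ1 hQ
  have h₂ := dissectionProduct_two_mul_qPoch hQ1 hQ
  have h₄ := dissectionProduct_four_mul_qPoch hQ1 hQ
  simp only [← pow_mul, Nat.reduceMul] at h₀ h₁ h₂ h₄
  have hne : qPoch (q ^ 5) (q ^ 5) ^ 2 * qPoch (q ^ 10) (q ^ 10) ≠ 0 :=
    mul_ne_zero (pow_ne_zero 2 (qPoch_ne_zero hQ1 hQ1)) (qPoch_pow_ten_ne_zero hq1)
  refine mul_right_cancel₀ hne ?_
  rw [genG1_mul_qPoch hq hq1, theta_five_dissection hq hq1]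
  linear_combination -h₀ - q * h₁ - q ^ 2 * h₂ - q ^ 4 * h₄

theorem differentiableOn_qPochList {U : Set ℂ} (hU : IsOpen U) {as : List (ℂ → ℂ)}
    (has : ∀ a ∈ as, DifferentiableOn ℂ a U) {b : ℂ → ℂ} (hb : DifferentiableOn ℂ b U)
    (hb1 : ∀ q ∈ U, ‖b q‖ < 1) :
    DifferentiableOn ℂ (fun q => qPochList (as.map fun a => a q) (b q)) U := by
  induction as with
  | nil => simp [qPochList]
  | cons a as ih =>
    simpa [qPochList] using! (differentiableOn_qPoch hU (has a (by simp)) hb hb1).mul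
      (ih fun c hc => has c (by simp [hc]))

theorem norm_pow_lt_one_of_mem_ball {q : ℂ} (hq : q ∈ Metric.ball (0 : ℂ) 1) {N : ℕ} (hN : N ≠ 0) :
    ‖q ^ N‖ < 1 :=
  norm_pow_lt_one (by simpa using hq) hN

theorem differentiableOn_genG1 : DifferentiableOn ℂ genG1 (Metric.ball (0 : ℂ) 1) := by
  have h₅ := differentiableOn_qPochList Metric.isOpen_ball
    (as := [fun q => -q, fun q => -q ^ 4])
    (by simp only [List.forall_mem_cons]; exact ⟨by fun_prop, by fun_prop, by simp⟩)
    (differentiableOn_pow 5) fun q hq => norm_pow_lt_one_of_mem_ball hq (by norm_num)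
  have h₁₀ := differentiableOn_qPochList Metric.isOpen_ball
    (as := [fun q => q ^ 4, fun q => q ^ 6])
    (by simp only [List.forall_mem_cons]; exact ⟨by fun_prop, by fun_prop, by simp⟩)
    (differentiableOn_pow 10) fun q hq => norm_pow_lt_one_of_mem_ball hq (by norm_num)
  exact (h₅.pow 2).mul h₁₀

theorem differentiableOn_qPochList_pow (ks : List ℕ) {N : ℕ} (hN : N ≠ 0) :
    DifferentiableOn ℂ (fun q => qPochList (ks.map fun k => q ^ k) (q ^ N))
      (Metric.ball (0 : ℂ) 1) := by
  have h := differentiableOn_qPochList Metric.isOpen_ball (as := ks.map fun k q => q ^ k)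
    (by simpa using fun k _ => differentiableOn_pow k)
    (differentiableOn_pow N) fun q hq => norm_pow_lt_one_of_mem_ball hq hN
  simpa only [List.map_map, Function.comp_def] using h

theorem differentiableOn_dissectionProduct (r : ℕ) :
    DifferentiableOn ℂ (dissectionProduct r) (Metric.ball (0 : ℂ) 1) := by
  have hdiff (c : ℂ) (ks ls : List ℕ) (hk : 0 ∉ ks) (hl : 0 ∉ ls) (n : ℕ) :
      DifferentiableOn ℂ (fun q => c / (qPochList (ks.map fun k => q ^ k) (q ^ 5) ^ n *
        qPochList (ls.map fun k => q ^ k) (q ^ 10))) (Metric.ball (0 : ℂ) 1) := by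
    refine (differentiableOn_const c).div (((differentiableOn_qPochList_pow ks (by norm_num)).pow
      n).mul (differentiableOn_qPochList_pow ls (by norm_num))) fun q hq => ?_
    have hq1 : ‖q‖ < 1 := by simpa using hq
    exact mul_ne_zero (pow_ne_zero _ (qPochList_pow_ne_zero hq1 hk (by norm_num)))
      (qPochList_pow_ne_zero hq1 hl (by norm_num))
  match r with
  | 0 =>
    exact (hdiff 1 [1, 4] [2, 8] (by simp) (by simp) 2).congr
      fun q _ => by simp [dissectionProduct]
  | 1 =>
    exact (hdiff 2 [1, 2, 3, 4] [2, 8] (by simp) (by simp) 1).congr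
      fun q _ => by simp [dissectionProduct]
  | 2 =>
    exact (hdiff 1 [1, 4] [4, 6] (by simp) (by simp) 2).congr
      fun q _ => by simp [dissectionProduct]
  | 3 => exact differentiableOn_const 0
  | 4 =>
    exact (hdiff 1 [2, 3] [4, 6] (by simp) (by simp) 2).congr
      fun q _ => by simp [dissectionProduct]
  | _ + 5 => exact differentiableOn_const 0

theorem hasSum_iteratedDeriv_div_factorial {f : ℂ → ℂ} {r : ℝ}
    (hf : DifferentiableOn ℂ f (Metric.ball 0 r)) {z : ℂ} (hz : ‖z‖ < r) :
    HasSum (fun n : ℕ => iteratedDeriv n f 0 / (n.factorial : ℂ) * z ^ n) (f z) := by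
  refine (Complex.hasSum_taylorSeries_on_ball hf (by simpa using hz)).congr_fun fun n => ?_
  simp only [sub_zero, smul_eq_mul]
  ring

theorem eq_of_eventually_hasSum_pow {𝕜 : Type*} [NontriviallyNormedField 𝕜] {f : 𝕜 → 𝕜}
    {c d : ℕ → 𝕜} (hc : ∀ᶠ q in 𝓝 0, HasSum (fun n => c n * q ^ n) (f q))
    (hd : ∀ᶠ q in 𝓝 0, HasSum (fun n => d n * q ^ n) (f q)) : c = d := by
  have hseries {c : ℕ → 𝕜} (hc : ∀ᶠ q in 𝓝 0, HasSum (fun n => c n * q ^ n) (f q)) :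
      HasFPowerSeriesAt f (FormalMultilinearSeries.ofScalars 𝕜 c) 0 := by
    rw [hasFPowerSeriesAt_iff]
    filter_upwards [hc] with q hq
    simpa [mul_comm] using hq
  have h := (hseries hc).eq_formalMultilinearSeries (hseries hd)
  funext n
  simpa using congrArg (fun p => p.coeff n) h

theorem hasSum_of_residue_components {R : Type*} [CommSemiring R] [TopologicalSpace R]
    [IsTopologicalSemiring R] {c : ℕ → ℕ → R} {G : ℕ → R} {q : R} {k : ℕ} (hk : k ≠ 0)
    (h : ∀ r < k, HasSum (fun n => c r n * (q ^ k) ^ n) (G r)) :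
    HasSum (fun n => c (n % k) (n / k) * q ^ n) (∑ r ∈ range k, q ^ r * G r) := by
  have hk' := Nat.pos_of_ne_zero hk
  have hcomponent : ∀ r ∈ range k,
      HasSum (fun n => if n % k = r then c (n % k) (n / k) * q ^ n else 0) (q ^ r * G r) := by
    intro r hr
    have hr' := mem_range.1 hr
    have hinj : Function.Injective fun n : ℕ => k * n + r := fun a b hab =>
      Nat.eq_of_mul_eq_mul_left hk' (Nat.add_right_cancel hab)
    refine (hinj.hasSum_iff fun n hn => if_neg fun hnr => hn ⟨n / k, ?_⟩).1 ?_
    · rw [← hnr]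
      exact Nat.div_add_mod n k
    · refine ((h r hr').mul_left (q ^ r)).congr_fun fun n => ?_
      simp only [Function.comp, Nat.mul_add_mod, Nat.mod_eq_of_lt hr', if_true,
        Nat.mul_add_div hk', Nat.div_eq_of_lt hr', add_zero]
      ring
  refine (hasSum_sum hcomponent).congr_fun fun n => ?_
  rw [sum_ite_eq, if_pos (mem_range.2 (Nat.mod_lt n hk'))]

theorem hasSum_g1 {q : ℂ} (hq1 : ‖q‖ < 1) : HasSum (fun n : ℕ => g1 n * q ^ n) (genG1 q) :=
  hasSum_iteratedDeriv_div_factorial differentiableOn_genG1 hq1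

theorem hasSum_dissectionProduct (r : ℕ) {q : ℂ} (hq1 : ‖q‖ < 1) :
    HasSum (fun n : ℕ => iteratedDeriv n (dissectionProduct r) 0 / (n.factorial : ℂ) * q ^ n)
      (dissectionProduct r q) :=
  hasSum_iteratedDeriv_div_factorial (differentiableOn_dissectionProduct r) hq1

theorem g1_eq_iteratedDeriv_dissectionProduct (n : ℕ) :
    g1 n = iteratedDeriv (n / 5) (dissectionProduct (n % 5)) 0 / ((n / 5).factorial : ℂ) := by
  have hball : ∀ᶠ q : ℂ in 𝓝 0, ‖q‖ < 1 :=
    (continuous_norm.tendsto' (0 : ℂ) 0 norm_zero).eventually_lt_const one_pos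
  refine congrFun (eq_of_eventually_hasSum_pow (hball.mono fun q => hasSum_g1)
    (d := fun n => iteratedDeriv (n / 5) (dissectionProduct (n % 5)) 0 / ((n / 5).factorial : ℂ))
    (hball.mono fun q hq1 => ?_)) n
  have h := hasSum_of_residue_components (q := q) (show 5 ≠ 0 by norm_num) fun r _ =>
    hasSum_dissectionProduct r (norm_pow_lt_one hq1 (show 5 ≠ 0 by norm_num))
  convert! h using 1
  simp [genG1_eq_dissection hq1, sum_range_succ, dissectionProduct]

theorem g1_five_mul_add {r : ℕ} (hr : r < 5) (n : ℕ) :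
    g1 (5 * n + r) = iteratedDeriv n (dissectionProduct r) 0 / (n.factorial : ℂ) := by
  rw [g1_eq_iteratedDeriv_dissectionProduct, Nat.mul_add_mod, Nat.mod_eq_of_lt hr,
    Nat.mul_add_div (by norm_num), Nat.div_eq_of_lt hr, add_zero]

theorem hasSum_g1_five_mul_add {r : ℕ} (hr : r < 5) {q : ℂ} (hq1 : ‖q‖ < 1) :
    HasSum (fun n : ℕ => g1 (5 * n + r) * q ^ n) (dissectionProduct r q) := by
  simp only [g1_five_mul_add hr]
  exact hasSum_dissectionProduct r hq1

theorem G1comp_eq {r : ℕ} (hr : r < 5) {q : ℂ} (hq1 : ‖q‖ < 1) :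
    G1comp r q = dissectionProduct r q := (hasSum_g1_five_mul_add hr hq1).tsum_eq

theorem g1_five_mul_add_three (n : ℕ) : g1 (5 * n + 3) = 0 := by
  have hzero : dissectionProduct 3 = fun _ => 0 := rfl
  simp [g1_five_mul_add (show 3 < 5 by norm_num), hzero]

theorem mainTheorem1 :
    (∀ q : ℂ, ‖q‖ < 1 →
      HasSum (fun n : ℕ => g1 n * q ^ n)
        (qPochList [-q, -q ^ 4] (q ^ 5) ^ 2 * qPochList [q ^ 4, q ^ 6] (q ^ 10)) ∧
      qPochList [-q, -q ^ 4] (q ^ 5) ^ 2 * qPochList [q ^ 4, q ^ 6] (q ^ 10) =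
        G1comp 0 (q ^ 5) + q * G1comp 1 (q ^ 5) + q ^ 2 * G1comp 2 (q ^ 5)
          + q ^ 4 * G1comp 4 (q ^ 5) ∧
      HasSum (fun n : ℕ => g1 (5 * n) * q ^ n)
        (1 / (qPochList [q, q ^ 4] (q ^ 5) ^ 2 * qPochList [q ^ 2, q ^ 8] (q ^ 10))) ∧
      HasSum (fun n : ℕ => g1 (5 * n + 1) * q ^ n)
        (2 / (qPochList [q, q ^ 2, q ^ 3, q ^ 4] (q ^ 5) *
          qPochList [q ^ 2, q ^ 8] (q ^ 10))) ∧
      HasSum (fun n : ℕ => g1 (5 * n + 2) * q ^ n)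
        (1 / (qPochList [q, q ^ 4] (q ^ 5) ^ 2 * qPochList [q ^ 4, q ^ 6] (q ^ 10))) ∧
      HasSum (fun n : ℕ => g1 (5 * n + 4) * q ^ n)
        (1 / (qPochList [q ^ 2, q ^ 3] (q ^ 5) ^ 2 * qPochList [q ^ 4, q ^ 6] (q ^ 10)))) ∧
    ∀ n : ℕ, g1 (5 * n + 3) = 0 := by
  refine ⟨fun q hq1 => ⟨hasSum_g1 hq1, ?_, hasSum_g1_five_mul_add (r := 0) (by norm_num) hq1,
    hasSum_g1_five_mul_add (by norm_num) hq1, hasSum_g1_five_mul_add (by norm_num) hq1,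
    hasSum_g1_five_mul_add (by norm_num) hq1⟩, g1_five_mul_add_three⟩
  have hQ1 := norm_pow_lt_one hq1 (show 5 ≠ 0 by norm_num)
  simp only [G1comp_eq _ hQ1, Nat.reduceLT]
  exact genG1_eq_dissection hq1
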